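/- A tournament is an orientation of a finite complete graph; it is transitive if, for all distinct vertices $u,v,w$, the presence of the arcs $\overrightarrow{uv}$ and $\overrightarrow{vw}$ implies the presence of the arc $\overrightarrow{uw}$. The chromatic number $\chi(S)$ of a tournament $S$ is the smallest number of parts in a partition of its vertex set in which each part induces a transitive tournament. A tournament is $T$-free if none of its subtournaments is isomorphic to $T$. Theorem. For every tournament $T$ there is a constant $C_T$ such that for every $n \in \mathbb{N}$ there is a tournament $S$ with $\chi(S) \ge n$ such that every $T$-free subtournament $R$ of $S$ satisfies $\chi(R) \le C_T$. -/

import Mathlib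

/-- A tournament on the vertex type `V`: an orientation of the complete graph on `V`, that is,
a loopless digraph in which every two distinct vertices are joined by an arc in exactly one
of the two directions. -/
structure Tournament (V : Type*) extends Digraph V where
  loopless : ∀ v, ¬ Adj v v
  adj_iff_not_adj : ∀ u v, u ≠ v → (Adj u v ↔ ¬ Adj v u)

namespace Tournament

/-- The subtournament of `T` induced by a set of vertices. -/
def induce {V : Type*} (T : Tournament V) (A : Set V) : Tournament A where
  Adj u v := T.Adj u v
  loopless v := T.loopless v
  adj_iff_not_adj u v h := T.adj_iff_not_adj u v (fun e => h (Subtype.ext e))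

/-- A tournament is transitive if, for all distinct vertices `u, v, w`, the presence of the arcs
`uv` and `vw` implies the presence of the arc `uw`. -/
def IsTransitive {V : Type*} (T : Tournament V) : Prop :=
  ∀ u v w, u ≠ v → v ≠ w → u ≠ w → T.Adj u v → T.Adj v w → T.Adj u w

/-- The chromatic number of a tournament: the least number of parts in a partition of the vertex
set in which every part induces a transitive tournament. -/
noncomputable def chromaticNumber {V : Type*} (T : Tournament V) : ℕ∞ :=
  ⨅ (P : Set (Set V))
    (_ : Setoid.IsPartition P ∧ ∀ A ∈ P, (T.induce A).IsTransitive), P.encard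

/-- `S` is `T`-free if it contains no copy of `T`, that is, no subtournament of `S` is isomorphic
to `T`. -/
def IsFree {W V : Type*} (S : Tournament W) (T : Tournament V) : Prop :=
  ∀ A : Set W, IsEmpty (T.Adj ≃r (S.induce A).Adj)

end Tournament

/-! Take an acyclic digraph with at most one directed path between any two vertices and huge
chromatic number (a Zykov-type construction). For a prime `p` and a set `A` of residues with `1 ∈
A`, `0 ∉ A`, extend reachability to a linear order and reverse the pairs joined by a path of length
in `A` modulo `p`. A colour class containing a walk of `p` arcs is not transitive: each arc is
reversed, but the pair of its ends is not. If no class has such a walk, `n * 2 ^ p` colours suffice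
for the digraph; hence `χ` is large. Choose `A` so that differences of residues `b i` encode the
backward arcs of `T`. A long walk with steps of constant length `g ∈ A` modulo `p` then contains
`T`, since `g` is invertible. So in a `T`-free set, for each `g ∈ A`, the pairs at distance `g` have
boundedly many colours; the product of these colourings has classes without backward arcs. -/

/-- A family of labelled pairs behaving like the lengths of directed paths in an acyclic digraph
in which any two vertices are joined by at most one directed path. -/
structure IsPathLength {W : Type*} (R : W → W → ℕ → Prop) : Prop where
  refl : ∀ u, R u u 0
  eq_of_zero : ∀ u v, R u v 0 → u = v
  unique : ∀ u v a b, R u v a → R u v b → a = b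
  add : ∀ u v w a b, R u v a → R v w b → R u w (a + b)

/-- Path lengths in the Zykov-type extension of a digraph: `m` copies of it, and for every choice
of one vertex in each copy a new vertex joined to the chosen ones. -/
def zykovPathLength {W : Type*} (R : W → W → ℕ → Prop) (m : ℕ) :
    (Fin m × W) ⊕ (Fin m → W) → (Fin m × W) ⊕ (Fin m → W) → ℕ → Prop
  | .inl x, .inl y, a => x.1 = y.1 ∧ R x.2 y.2 a
  | .inl x, .inr f, a => ∃ b, a = b + 1 ∧ R x.2 (f x.1) b
  | .inr _, .inl _, _ => False
  | .inr f, .inr g, a => f = g ∧ a = 0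

/-- New vertices have no out-arcs and receive one arc from each copy, so a path from copy `i` to `f`
is a path to `f i` followed by one arc. -/
theorem IsPathLength.zykov {W : Type*} {R : W → W → ℕ → Prop} (hR : IsPathLength R) (m : ℕ) :
    IsPathLength (zykovPathLength R m) where
  refl u := by
    rcases u with x | f
    · exact ⟨rfl, hR.refl _⟩
    · exact ⟨rfl, rfl⟩
  eq_of_zero u v h := by
    rcases u with ⟨i, x⟩ | f <;> rcases v with ⟨j, y⟩ | g
    · obtain ⟨h1, h2⟩ := h
      have := hR.eq_of_zero _ _ h2
      simp_all
    · obtain ⟨b, hb, -⟩ := h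
      omega
    · exact h.elim
    · rw [h.1]
  unique u v a b h h' := by
    rcases u with ⟨i, x⟩ | f <;> rcases v with ⟨j, y⟩ | g
    · exact hR.unique _ _ _ _ h.2 h'.2
    · obtain ⟨c, rfl, hc⟩ := h
      obtain ⟨d, rfl, hd⟩ := h'
      rw [hR.unique _ _ _ _ hc hd]
    · exact h.elim
    · rw [h.2, h'.2]
  add u v w a b h h' := by
    rcases u with ⟨i, x⟩ | f <;> rcases v with ⟨j, y⟩ | g <;> rcases w with ⟨k, z⟩ | e
    · exact ⟨h.1.trans h'.1, hR.add _ _ _ _ _ h.2 h'.2⟩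
    · obtain ⟨c, rfl, hc⟩ := h'
      obtain ⟨h1, h2⟩ := h
      simp only at h1
      subst h1
      exact ⟨a + c, by omega, hR.add _ _ _ _ _ h2 hc⟩
    · exact h'.elim
    · obtain ⟨rfl, rfl⟩ := h'
      exact h
    · exact h.elim
    · exact h.elim
    · exact h'.elim
    · obtain ⟨rfl, rfl⟩ := h
      obtain ⟨rfl, rfl⟩ := h'
      exact ⟨rfl, rfl⟩

/-- There are digraphs with unique directed paths and arbitrarily large chromatic number. -/
theorem exists_isPathLength_not_colorable (m : ℕ) :
    ∃ (W : Type) (_ : Finite W) (R : W → W → ℕ → Prop), IsPathLength R ∧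
      ∀ c : W → Fin m, ∃ u v, R u v 1 ∧ c u = c v := by
  induction m with
  | zero =>
    refine ⟨Unit, inferInstance, fun _ _ a => a = 0, ⟨?_, ?_, ?_, ?_⟩, fun c => (c ()).elim0⟩ <;>
      intros <;> first | rfl | omega
  | succ m ih =>
    obtain ⟨W, hW, R, hR, hc⟩ := ih
    refine ⟨_, inferInstance, _, hR.zykov (m + 1), fun c => ?_⟩
    -- If every copy `i` contains colour `i`, the new vertex over such a choice clashes with its
    -- in-neighbour in the copy indexed by its own colour. Otherwise some copy `i` avoids colour `i`
    -- and uses only `m` colours.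
    by_cases h : ∀ i, ∃ w, c (.inl (i, w)) = i
    · choose f hf using h
      refine ⟨.inl (c (.inr f), f (c (.inr f))), .inr f, ⟨0, rfl, hR.refl _⟩, hf _⟩
    · push Not at h
      obtain ⟨i, hi⟩ := h
      obtain ⟨u, v, h1, h2⟩ := hc fun w => (finSuccAboveEquiv i).symm ⟨c (.inl (i, w)), hi w⟩
      refine ⟨.inl (i, u), .inl (i, v), ⟨rfl, h1⟩, ?_⟩
      simpa using h2

/-! ### Walks versus colourings -/

/-- A relation without a walk of `N` steps is properly coloured by the sets of lengths of walks
ending at a vertex. -/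
theorem exists_walk_or_coloring {α : Type*} (E : α → α → Prop) (N : ℕ) :
    (∃ x : ℕ → α, ∀ i < N, E (x i) (x (i + 1))) ∨
      ∃ f : α → Set (Fin N), ∀ u v, E u v → f u ≠ f v := by
  by_contra! hcon
  obtain ⟨hN, hf⟩ := hcon
  let P : ℕ → α → Prop := fun j v => ∃ x : ℕ → α, x j = v ∧ ∀ i < j, E (x i) (x (i + 1))
  obtain ⟨u, v, huv, h⟩ := hf fun v => {j : Fin N | P j v}
  -- Walk lengths at `u` shift by one at `v`; if both sets agree, every length up to `N` occurs at
  -- `v`.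
  have step : ∀ j, P j u → P (j + 1) v := by
    rintro j ⟨x, rfl, hx⟩
    refine ⟨Function.update x (j + 1) v, by simp, fun i hi => ?_⟩
    rw [Function.update_of_ne (by omega)]
    rcases Nat.lt_succ_iff_lt_or_eq.1 hi with hi | rfl
    · rw [Function.update_of_ne (by omega)]
      exact hx i hi
    · simpa using huv
  have key : ∀ j ≤ N, P j v := by
    intro j hj
    induction j with
    | zero => exact ⟨fun _ => v, rfl, by omega⟩
    | succ j ih =>
      apply step
      have : (⟨j, hj⟩ : Fin N) ∈ {j : Fin N | P j v} := ih (by omega)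
      rw [← h] at this
      exact this
  obtain ⟨x, -, hx⟩ := key N le_rfl
  obtain ⟨i, hi, hi'⟩ := hN x
  exact hi' (hx i hi)

/-! ### Encoding a pattern by residues -/

/-- Differences of powers of two determine the exponents. -/
theorem two_pow_sub_two_pow_inj {i j i' j' : ℕ} (h : i < j) (h' : i' < j')
    (he : 2 ^ j - 2 ^ i = 2 ^ j' - 2 ^ i') : i = i' ∧ j = j' := by
  -- The difference lies in `[2 ^ (j - 1), 2 ^ j)`, which determines `j`.
  have aux : ∀ {i j i' j' : ℕ}, i < j → i' < j' → 2 ^ j - 2 ^ i = 2 ^ j' - 2 ^ i' → j' ≤ j := by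
    intro i j i' j' h h' he
    by_contra! hj
    obtain ⟨k, rfl⟩ := Nat.exists_eq_succ_of_ne_zero (by omega : j' ≠ 0)
    have h1 : 2 ^ j ≤ 2 ^ k := Nat.pow_le_pow_right (by norm_num) (by omega)
    have h2 : 2 ^ i' ≤ 2 ^ k := Nat.pow_le_pow_right (by norm_num) (by omega)
    have h3 : 0 < 2 ^ i := by positivity
    have h4 : 2 ^ (k + 1) = 2 ^ k * 2 := pow_succ 2 k
    have h5 : 2 ^ i < 2 ^ j := Nat.pow_lt_pow_right (by norm_num) h
    simp only [Nat.succ_eq_add_one] at he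
    omega
  obtain rfl : j = j' := le_antisymm (aux h' h he.symm) (aux h h' he)
  have h1 : 2 ^ i < 2 ^ j := Nat.pow_lt_pow_right (by norm_num) h
  have h2 : 2 ^ i' < 2 ^ j := Nat.pow_lt_pow_right (by norm_num) h'
  exact ⟨Nat.pow_right_injective le_rfl (by simp only; omega), rfl⟩

/-- Every binary pattern on the pairs `i < j` is realised by the differences of some residues
modulo a prime `p`, with respect to a set of residues containing `1` but not `0`. -/
theorem exists_residues_of_pattern (k : ℕ) (Q : Fin k → Fin k → Prop) :
    ∃ (p : ℕ) (_ : Fact p.Prime) (A : ZMod p → Prop) (b : Fin k → ZMod p),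
      A 1 ∧ ¬ A 0 ∧ ∀ i j, i < j → (A (b j - b i) ↔ Q i j) := by
  obtain ⟨p, hp, hpp⟩ := Nat.exists_infinite_primes (2 ^ (k + 1) + 1)
  have : Fact p.Prime := ⟨hpp⟩
  have hlt : ∀ {i j : Fin k}, i < j → 2 ^ (i.1 + 1) < 2 ^ (j.1 + 1) := fun h =>
    Nat.pow_lt_pow_right (by norm_num) (by simpa using h)
  have hbd : ∀ i j : Fin k, 2 ^ (j.1 + 1) - 2 ^ (i.1 + 1) < p := fun i j =>
    (Nat.sub_le _ _).trans_lt (lt_of_le_of_lt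
      (Nat.pow_le_pow_right (by norm_num) (by omega)) (Nat.lt_of_succ_le hp))
  have hsub : ∀ {i j : Fin k}, i < j →
      (2 : ZMod p) ^ (j.1 + 1) - 2 ^ (i.1 + 1) = ((2 ^ (j.1 + 1) - 2 ^ (i.1 + 1) : ℕ) : ZMod p) := by
    intro i j h
    rw [Nat.cast_sub (hlt h).le]
    push_cast
    rfl
  have hinj : ∀ {x y : ℕ}, x < p → y < p → (x : ZMod p) = y → x = y := by
    intro x y hx hy h
    rw [ZMod.natCast_eq_natCast_iff'] at h
    rwa [Nat.mod_eq_of_lt hx, Nat.mod_eq_of_lt hy] at h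
  -- The exponents `i + 1` make all differences even, hence distinct from `1`; as `p` exceeds them,
  -- nothing wraps around.
  refine ⟨p, this, fun x => x = 1 ∨ ∃ i j : Fin k, i < j ∧ Q i j ∧
      x = (2 : ZMod p) ^ (j.1 + 1) - 2 ^ (i.1 + 1), fun i => 2 ^ (i.1 + 1), Or.inl rfl, ?_, ?_⟩
  · rintro (h | ⟨i, j, hij, -, h⟩)
    · exact zero_ne_one h
    · rw [hsub hij] at h
      have h1 := hinj hpp.pos (hbd i j) (by simpa only [Nat.cast_zero] using h)
      have := hlt hij
      omega
  · intro i j hij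
    refine ⟨?_, fun h => Or.inr ⟨i, j, hij, h, rfl⟩⟩
    rintro (h | ⟨i', j', hij', hQ, h⟩)
    · rw [hsub hij] at h
      have h1 := hinj (hbd i j) hpp.one_lt (by simpa only [Nat.cast_one] using h)
      have h2 := pow_succ 2 j.1
      have h3 := pow_succ 2 i.1
      omega
    · rw [hsub hij, hsub hij'] at h
      have h1 := hinj (hbd i j) (hbd i' j') h
      obtain ⟨h2, h3⟩ := two_pow_sub_two_pow_inj (by simpa using hij) (by simpa using hij') h1
      obtain rfl : i = i' := Fin.ext (by omega)
      obtain rfl : j = j' := Fin.ext (by omega)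
      exact hQ

/-! ### Linear extension and labels along walks -/

namespace IsPathLength

variable {W : Type*} {R : W → W → ℕ → Prop}

/-- Reachability is a partial order and so extends to a linear order. -/
theorem exists_linearOrder (hR : IsPathLength R) :
    ∃ _ : LinearOrder W, ∀ u v a, R u v a → u ≤ v := by
  classical
  let r : W → W → Prop := fun u v => ∃ a, R u v a
  have : IsPartialOrder W r :=
    { refl := fun u => ⟨0, hR.refl u⟩
      trans := fun u v w ⟨a, ha⟩ ⟨b, hb⟩ => ⟨a + b, hR.add _ _ _ _ _ ha hb⟩
      -- A closed path has the length of the trivial one, by uniqueness.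
      antisymm := fun u v ⟨a, ha⟩ ⟨b, hb⟩ => by
        have := hR.unique _ _ _ _ (hR.add _ _ _ _ _ ha hb) (hR.refl u)
        obtain rfl : a = 0 := by omega
        exact hR.eq_of_zero _ _ ha }
  obtain ⟨s, hs, hrs⟩ := extend_partialOrder r
  exact ⟨{ le := s
           le_refl := hs.refl
           le_trans := hs.trans
           le_antisymm := hs.antisymm
           le_total := hs.total
           toDecidableLE := Classical.decRel _ }, fun u v a h => hrs u v ⟨a, h⟩⟩

/-- Labels add up along walks whose steps all have label `g`. -/
theorem exists_label_of_walk (hR : IsPathLength R) {p : ℕ} {g : ZMod p} {N : ℕ} {x : ℕ → W}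
    (hx : ∀ i < N, ∃ a, R (x i) (x (i + 1)) a ∧ (a : ZMod p) = g) {i j : ℕ} (hij : i ≤ j)
    (hj : j ≤ N) : ∃ a, R (x i) (x j) a ∧ (a : ZMod p) = ((j : ZMod p) - i) * g := by
  induction j, hij using Nat.le_induction with
  | base => exact ⟨0, hR.refl _, by simp⟩
  | succ j hij ih =>
    obtain ⟨a, ha, ha'⟩ := ih (by omega)
    obtain ⟨b, hb, hb'⟩ := hx j hj
    refine ⟨a + b, hR.add _ _ _ _ _ ha hb, ?_⟩
    push_cast
    rw [ha', hb']
    ring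

end IsPathLength

/-! ### Backward arcs and colourings of tournaments -/

namespace Tournament

/-- The tournament on a linearly ordered set in which the pairs in `B` are the backward arcs. -/
def ofBackward {W : Type*} [LinearOrder W] (B : W → W → Prop) : Tournament W where
  Adj u v := (u < v ∧ ¬ B u v) ∨ (v < u ∧ B v u)
  loopless v := by simp
  adj_iff_not_adj u v h := by
    rcases lt_or_gt_of_ne h with h | h <;> simp [h, h.not_gt]

theorem ofBackward_adj_of_lt {W : Type*} [LinearOrder W] {B : W → W → Prop} {u v : W}
    (h : u < v) : (ofBackward B).Adj u v ↔ ¬ B u v := by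
  simp [ofBackward, h, h.not_gt]

theorem ofBackward_adj_of_gt {W : Type*} [LinearOrder W] {B : W → W → Prop} {u v : W}
    (h : v < u) : (ofBackward B).Adj u v ↔ B v u := by
  simp [ofBackward, h, h.not_gt]

theorem not_isFree_of_embedding {V W : Type*} {T : Tournament V} {S : Tournament W} (f : V → W)
    (hf : Function.Injective f) (h : ∀ u v, T.Adj u v ↔ S.Adj (f u) (f v)) : ¬ S.IsFree T :=
  fun hS => (hS (Set.range f)).false
    { toEquiv := Equiv.ofInjective f hf
      map_rel_iff' := fun {u v} => (h u v).symm }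

theorem chromaticNumber_le_of_coloring {W K : Type*} [Finite K] (S : Tournament W) (f : W → K)
    (h : ∀ u v w, u ≠ v → v ≠ w → u ≠ w → f u = f v → f v = f w →
      S.Adj u v → S.Adj v w → S.Adj u w) :
    S.chromaticNumber ≤ (Nat.card K : ℕ∞) := by
  have hle : (Setoid.ker f).classes.encard ≤ (Nat.card K : ℕ∞) := by
    have : Fintype K := Fintype.ofFinite K
    have hsub : (Setoid.ker f).classes ⊆ Set.range fun y => {x | f x = y} :=
      Setoid.classes_ker_subset_fiber_set f
    refine (Set.encard_le_encard hsub).trans ?_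
    rw [← Set.image_univ]
    refine (Set.encard_image_le _ _).trans ?_
    rw [Set.encard_univ, ENat.card_eq_coe_natCard]
  refine (iInf₂_le (Setoid.ker f).classes ⟨Setoid.isPartition_classes _, ?_⟩).trans hle
  rintro A ⟨y, rfl⟩ ⟨u, hu⟩ ⟨v, hv⟩ ⟨w, hw⟩ huv hvw huw
  simp only [Setoid.ker_def, Set.mem_ofPred_eq] at hu hv hw
  exact h u v w (by simpa using huv) (by simpa using hvw) (by simpa using huw)
    (hu.trans hv.symm) (hv.trans hw.symm)

theorem le_chromaticNumber_of_coloring {W : Type*} (S : Tournament W) (n : ℕ)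
    (h : ∀ c : W → Fin n, ∃ y, ¬ (S.induce (c ⁻¹' {y})).IsTransitive) :
    (n : ℕ∞) ≤ S.chromaticNumber := by
  refine le_iInf₂ fun P ⟨hP, hPt⟩ => ?_
  by_contra! hlt
  have hfin : P.Finite := Set.finite_of_encard_le_coe hlt.le
  have : Fintype P := hfin.fintype
  have hcard : Fintype.card P ≤ n := by
    rw [← Set.coe_fintypeCard] at hlt
    exact_mod_cast hlt.le
  choose q hq hq' using fun v => (hP.2 v).exists
  obtain ⟨e⟩ : Nonempty (P ↪ Fin n) := Function.Embedding.nonempty_of_card_le (by simpa using hcard)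
  obtain ⟨y, hy⟩ := h fun v => e ⟨q v, hq v⟩
  apply hy
  intro u v w huv hvw huw
  have key : ∀ a b : W, e ⟨q a, hq a⟩ = e ⟨q b, hq b⟩ → a ∈ q b := by
    intro a b hab
    have := congrArg Subtype.val (e.injective hab)
    simp only at this
    exact this ▸ hq' a
  have hu := u.2
  have hv := v.2
  have hw := w.2
  simp only [Set.mem_preimage, Set.mem_singleton_iff] at hu hv hw
  exact hPt _ (hq u) ⟨u, key _ _ rfl⟩ ⟨v, key _ _ (hv.trans hu.symm)⟩
    ⟨w, key _ _ (hw.trans hu.symm)⟩ (by simpa [Subtype.ext_iff] using huv)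
    (by simpa [Subtype.ext_iff] using hvw) (by simpa [Subtype.ext_iff] using huw)

/-- In a transitive tournament the last vertex of a walk dominates, or is, the first. -/
theorem IsTransitive.adj_or_eq_of_walk {W : Type*} {S : Tournament W} (hS : S.IsTransitive)
    {x : ℕ → W} {N : ℕ} (hx : ∀ i < N, S.Adj (x (i + 1)) (x i)) :
    ∀ i ≤ N, S.Adj (x i) (x 0) ∨ x i = x 0 := by
  intro i hi
  induction i with
  | zero => exact Or.inr rfl
  | succ i ih =>
    have h1 := hx i hi
    by_cases h0 : x (i + 1) = x 0
    · exact Or.inr h0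
    refine Or.inl ?_
    rcases ih (by omega) with h | h
    · refine hS _ _ _ ?_ ?_ h0 h1 h
      · intro he
        exact S.loopless _ (he ▸ h1)
      · intro he
        exact S.loopless _ (he ▸ h)
    · rwa [h] at h1

end Tournament

/-! ### The lower and upper bounds on the chromatic number -/

section PathLengthTournament

variable {W : Type*} {R : W → W → ℕ → Prop} {p : ℕ} {A : ZMod p → Prop}

/-- Pairs joined by a directed path whose length modulo `p` lies in `A`. -/
def lengthMem (R : W → W → ℕ → Prop) (A : ZMod p → Prop) (u v : W) : Prop :=
  ∃ a, R u v a ∧ A a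

theorem IsPathLength.lengthMem_iff (hR : IsPathLength R) {u v : W} {a : ℕ} (h : R u v a) :
    lengthMem R A u v ↔ A a :=
  ⟨fun ⟨_, hb, hA⟩ => hR.unique _ _ _ _ hb h ▸ hA, fun hA => ⟨a, h, hA⟩⟩

variable [LinearOrder W]

/-- The only label of a pair `(u, u)` is `0`, so a step with nonzero residue moves strictly up. -/
theorem IsPathLength.lt_of_walk (hR : IsPathLength R) (hle : ∀ u v a, R u v a → u ≤ v)
    {g : ZMod p} (hg : g ≠ 0) {N : ℕ} {x : ℕ → W}
    (hx : ∀ i < N, ∃ a, R (x i) (x (i + 1)) a ∧ (a : ZMod p) = g) {i j : ℕ} (hij : i < j)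
    (hj : j ≤ N) : x i < x j := by
  obtain ⟨a, ha, ha'⟩ := hx i (by omega)
  obtain ⟨b, hb, -⟩ := hR.exists_label_of_walk hx hij hj
  refine lt_of_lt_of_le (lt_of_le_of_ne (hle _ _ _ ha) ?_) (hle _ _ _ hb)
  intro he
  rw [← he] at ha
  rw [hR.unique _ _ _ _ ha (hR.refl _)] at ha'
  exact hg (by simpa using ha'.symm)

/-- If the digraph has no proper colouring with `n * 2 ^ p` colours, then the associated
tournament has chromatic number at least `n`. -/
theorem IsPathLength.le_chromaticNumber [NeZero p] (hR : IsPathLength R)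
    (hle : ∀ u v a, R u v a → u ≤ v) (h1 : A 1) (h0 : ¬ A 0) (n : ℕ)
    (hc : ∀ c : W → Fin n × Set (Fin p), ∃ u v, R u v 1 ∧ c u = c v) :
    (n : ℕ∞) ≤ (Tournament.ofBackward (lengthMem R A)).chromaticNumber := by
  refine Tournament.le_chromaticNumber_of_coloring _ n fun c => ?_
  rcases exists_walk_or_coloring (fun u v => R u v 1 ∧ c u = c v) p with ⟨x, hx⟩ | ⟨f, hf⟩
  · have hcx : ∀ i ≤ p, c (x i) = c (x 0) := by
      intro i hi
      induction i with
      | zero => rfl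
      | succ i ih => rw [← (hx i hi).2, ih (by omega)]
    refine ⟨c (x 0), fun ht => ?_⟩
    have hne : (1 : ZMod p) ≠ 0 := fun h => h0 (h ▸ h1)
    have hstep : ∀ i < p, ∃ a, R (x i) (x (i + 1)) a ∧ (a : ZMod p) = 1 := fun i hi =>
      ⟨1, (hx i hi).1, by simp⟩
    have hlt := hR.lt_of_walk hle hne hstep (NeZero.pos p) le_rfl
    let y : ℕ → (c ⁻¹' {c (x 0)} : Set W) := fun i => ⟨x (min i p), hcx _ (min_le_right _ _)⟩
    have hy := ht.adj_or_eq_of_walk (x := y) (N := p) (fun i hi => by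
      change (Tournament.ofBackward (lengthMem R A)).Adj (x (min (i + 1) p)) (x (min i p))
      rw [min_eq_left (by omega), min_eq_left (by omega), Tournament.ofBackward_adj_of_gt
        (hR.lt_of_walk hle hne hstep (Nat.lt_succ_self i) hi), hR.lengthMem_iff (hx i hi).1]
      simpa using h1) p le_rfl
    have hy0 : (y 0).1 = x 0 := by simp [y]
    have hyp : (y p).1 = x p := by simp [y]
    rcases hy with hy | hy
    · change (Tournament.ofBackward (lengthMem R A)).Adj (y p).1 (y 0).1 at hy
      rw [hy0, hyp, Tournament.ofBackward_adj_of_gt hlt] at hy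
      -- The length from `x 0` to `x p` is `0` modulo `p`, so this pair is not reversed.
      obtain ⟨a, ha, ha'⟩ := hR.exists_label_of_walk hstep (Nat.zero_le p) le_rfl
      rw [hR.lengthMem_iff ha, ha'] at hy
      exact h0 (by simpa using hy)
    · exact hlt.ne (by rw [← hy0, ← hyp, hy])
  · obtain ⟨u, v, huv, he⟩ := hc fun w => (c w, f w)
    simp only [Prod.mk.injEq] at he
    exact absurd he.2 (hf u v ⟨huv, he.1⟩)

/-- A long walk with steps of a constant nonzero label contains every tournament whose pattern of
backward arcs is realised by differences of residues. -/
theorem IsPathLength.not_isFree_of_walk [Fact p.Prime] (hR : IsPathLength R)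
    (hle : ∀ u v a, R u v a → u ≤ v) {V : Type*} {T : Tournament V} {k : ℕ} (e : V ≃ Fin k)
    {b : Fin k → ZMod p}
    (hb : ∀ i j, i < j → (A (b j - b i) ↔ T.Adj (e.symm j) (e.symm i)))
    {g : ZMod p} (hg : g ≠ 0) {X : Set W} {x : ℕ → X}
    (hx : ∀ i < p * k, ∃ a, R (x i) (x (i + 1)) a ∧ (a : ZMod p) = g) :
    ¬ ((Tournament.ofBackward (lengthMem R A)).induce X).IsFree T := by
  -- Positions congruent to `b i / g`, spread over successive blocks of length `p` to be increasing;
  -- `k` blocks suffice.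
  let a : Fin k → ℕ := fun i => (b i / g).val + p * i
  have hamono : ∀ {i j}, i < j → a i < a j := by
    intro i j hij
    have h1 := ZMod.val_lt (b i / g)
    have h2 : p * (i.1 + 1) ≤ p * j.1 := Nat.mul_le_mul_left p hij
    simp only [a]
    rw [mul_add] at h2
    omega
  have hak : ∀ i, a i ≤ p * k := by
    intro i
    have h1 := ZMod.val_lt (b i / g)
    have h2 : p * (i.1 + 1) ≤ p * k := Nat.mul_le_mul_left p i.2
    simp only [a]
    rw [mul_add] at h2
    omega
  have hcast : ∀ i, (a i : ZMod p) * g = b i := by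
    intro i
    simp [a, hg]
  have hlt : ∀ {i j}, i < j → (x (a i)).1 < (x (a j)).1 := fun hij =>
    hR.lt_of_walk hle hg (x := fun i => (x i).1) hx (hamono hij) (hak _)
  have hmem : ∀ {i j}, i < j →
      (lengthMem R A (x (a i)).1 (x (a j)).1 ↔ T.Adj (e.symm j) (e.symm i)) := by
    intro i j hij
    obtain ⟨l, hl, hl'⟩ := hR.exists_label_of_walk (x := fun i => (x i).1) hx (hamono hij).le
      (hak _)
    rw [hR.lengthMem_iff hl, hl', sub_mul, hcast, hcast, hb i j hij]
  refine Tournament.not_isFree_of_embedding (fun v => x (a (e v))) ?_ fun u v => ?_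
  · intro u v huv
    by_contra hne
    rcases lt_or_gt_of_ne (e.injective.ne hne) with h | h
    · exact (hlt h).ne (congrArg Subtype.val huv)
    · exact (hlt h).ne' (congrArg Subtype.val huv)
  · change _ ↔ (Tournament.ofBackward (lengthMem R A)).Adj (x (a (e u))).1 (x (a (e v))).1
    rcases lt_trichotomy (e u) (e v) with h | h | h
    · have hne : u ≠ v := fun he => h.ne (congrArg e he)
      rw [Tournament.ofBackward_adj_of_lt (hlt h), hmem h, T.adj_iff_not_adj u v hne]
      simp
    · obtain rfl := e.injective h
      exact iff_of_false (T.loopless _) (Tournament.loopless _ _)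
    · rw [Tournament.ofBackward_adj_of_gt (hlt h), hmem h]
      simp

/-- Freeness excludes walks of `p * k` steps for each residue `g ∈ A`, which gives one colouring per
`g`. Within a class of their product the tournament follows the linear order. -/
theorem IsPathLength.chromaticNumber_le_of_isFree [Fact p.Prime] (hR : IsPathLength R)
    (hle : ∀ u v a, R u v a → u ≤ v) (h0 : ¬ A 0) {V : Type*} {T : Tournament V} {k : ℕ}
    (e : V ≃ Fin k) {b : Fin k → ZMod p}
    (hb : ∀ i j, i < j → (A (b j - b i) ↔ T.Adj (e.symm j) (e.symm i))) (X : Set W)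
    (hX : ((Tournament.ofBackward (lengthMem R A)).induce X).IsFree T) :
    ((Tournament.ofBackward (lengthMem R A)).induce X).chromaticNumber ≤
      (Nat.card (ZMod p → Set (Fin (p * k))) : ℕ∞) := by
  have hcol : ∀ g : ZMod p, ∃ f : X → Set (Fin (p * k)), A g → ∀ u v : X,
      (∃ a, R u v a ∧ (a : ZMod p) = g) → f u ≠ f v := by
    intro g
    by_cases hA : A g
    · rcases exists_walk_or_coloring (fun u v : X => ∃ a, R u v a ∧ (a : ZMod p) = g) (p * k)
        with ⟨x, hx⟩ | ⟨f, hf⟩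
      · exact absurd hX (hR.not_isFree_of_walk hle e hb (fun h => h0 (h ▸ hA)) hx)
      · exact ⟨f, fun _ => hf⟩
    · exact ⟨fun _ => ∅, fun h => absurd h hA⟩
  choose f hf using hcol
  have hno : ∀ u v : X, (fun g => f g u) = (fun g => f g v) → ¬ lengthMem R A u.1 v.1 := by
    rintro u v huv ⟨a, ha, hA⟩
    exact hf a hA u v ⟨a, ha, rfl⟩ (congrFun huv _)
  have hiff : ∀ u v : X, u ≠ v → (fun g => f g u) = (fun g => f g v) →
      (((Tournament.ofBackward (lengthMem R A)).induce X).Adj u v ↔ u < v) := by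
    intro u v hne huv
    change (Tournament.ofBackward (lengthMem R A)).Adj u.1 v.1 ↔ _
    rcases lt_or_gt_of_ne hne with h | h
    · rw [Tournament.ofBackward_adj_of_lt (show u.1 < v.1 from h)]
      exact iff_of_true (hno u v huv) h
    · rw [Tournament.ofBackward_adj_of_gt (show v.1 < u.1 from h)]
      exact iff_of_false (hno v u huv.symm) h.not_gt
  refine Tournament.chromaticNumber_le_of_coloring _ (fun u g => f g u) ?_
  intro u v w huv hvw huw h1 h2
  rw [hiff u v huv h1, hiff v w hvw h2, hiff u w huw (h1.trans h2)]
  exact lt_trans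

end PathLengthTournament

theorem theorem1p7 {V : Type*} [Finite V] (T : Tournament V) :
    ∃ C : ℕ, ∀ n : ℕ, ∃ (W : Type) (_ : Finite W) (S : Tournament W),
      (n : ℕ∞) ≤ S.chromaticNumber ∧
        ∀ A : Set W, (S.induce A).IsFree T → (S.induce A).chromaticNumber ≤ (C : ℕ∞) := by
  let e := Finite.equivFin V
  obtain ⟨p, hp, A, b, h1, h0, hb⟩ := exists_residues_of_pattern (Nat.card V)
    fun i j => T.Adj (e.symm j) (e.symm i)
  -- The data `p`, `A`, `b` depend on `T` alone, so the bound is fixed before `n`; only the digraph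
  -- varies with `n`.
  refine ⟨Nat.card (ZMod p → Set (Fin (p * Nat.card V))), fun n => ?_⟩
  obtain ⟨W, hW, R, hR, hc⟩ :=
    exists_isPathLength_not_colorable (Nat.card (Fin n × Set (Fin p)))
  obtain ⟨_, hle⟩ := hR.exists_linearOrder
  refine ⟨W, hW, Tournament.ofBackward (lengthMem R A), ?_, ?_⟩
  · refine hR.le_chromaticNumber hle h1 h0 n fun c => ?_
    obtain ⟨u, v, huv, h⟩ := hc fun w => Finite.equivFin _ (c w)
    exact ⟨u, v, huv, (Finite.equivFin _).injective h⟩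
  · exact hR.chromaticNumber_le_of_isFree hle h0 e hb
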